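/- For a linear order $L$ and two $n$-tuples $e,e'$ of elements of $L$, let $t(e,e')\in\{0,1\}^n$ be the binary tuple whose $i$-th entry is $1$ if and only if $e'_i<e_i$. Say that $e,e'$ realize $t\in\{0,1\}^n$ if $t(e,e')=t$ or $t(e,e')=\neg t$, where $\neg t=(1-t_i)_{i<n}$. For an infinite cardinal $\kappa$ and an integer $n>0$, $L$ is called $(\kappa,n)$-entangled if $|L|\ge\kappa$ and, for every collection $F$ of size $\kappa$ of injective $n$-tuples of elements of $L$ with pairwise disjoint ranges and every $t\in\{0,1\}^n$, there are two distinct elements of $F$ that realize $t$. Let $\mathrm{cov}(\mathcal B)$ be the least cardinal $\kappa$ such that $\mathbb R$ is the union of $\kappa$ many meager sets. Theorem. Assume $\mathrm{cov}(\mathcal B)=2^{\aleph_0}$. Then for every integer $n>1$ there is a set $E\subseteq\mathbb R$ which, with its usual order, is $(2^{\aleph_0},n)$-entangled but not $(2^{\aleph_0},n+1)$-entangled. In particular, if the continuum hypothesis $2^{\aleph_0}=\aleph_1$ holds, then for every integer $n>1$ there is a set of reals which is $(\aleph_1,n)$-entangled but not $(\aleph_1,n+1)$-entangled. -/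

import Mathlib

open Cardinal

universe u

namespace Entangled

/-- The binary type `t(e, e')` of two `n`-tuples in a linear order: its `i`-th entry is
`1` (`true`) if and only if `e' i < e i`. -/
def tupleType {L : Type u} [LinearOrder L] {n : ℕ} (e e' : Fin n → L) : Fin n → Bool :=
  fun i => decide (e' i < e i)

/-- The tuples `e` and `e'` realize the binary tuple `t` if `t(e, e')` is `t` or its
complement `¬t`. -/
def Realizes {L : Type u} [LinearOrder L] {n : ℕ} (e e' : Fin n → L) (t : Fin n → Bool) : Prop :=
  tupleType e e' = t ∨ tupleType e e' = fun i => !(t i)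

/-- The linear order `L` is `(κ, n)`-entangled (for an infinite cardinal `κ` and `n > 0`):
it has at least `κ` elements, and for every collection `F` of `κ` many injective, mutually
disjoint `n`-tuples of `L` and every binary `n`-tuple `t`, two distinct elements of `F`
realize `t`. -/
def IsEntangled (κ : Cardinal.{u}) (n : ℕ) (L : Type u) [LinearOrder L] : Prop :=
  κ ≤ #L ∧
    ∀ F : Set (Fin n → L), #F = κ →
      (∀ e ∈ F, Function.Injective e) →
      (∀ e ∈ F, ∀ e' ∈ F, e ≠ e' → Disjoint (Set.range e) (Set.range e')) →
      ∀ t : Fin n → Bool, ∃ e ∈ F, ∃ e' ∈ F, e ≠ e' ∧ Realizes e e' t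

/-- The covering number of the meager ideal: the least cardinal `κ` such that the real line
is the union of `κ` many meager sets. -/
noncomputable def covMeager : Cardinal.{0} :=
  sInf {κ | ∃ S : Set (Set ℝ), #S = κ ∧ (∀ A ∈ S, IsMeagre A) ∧ ⋃₀ S = Set.univ}

end Entangled

namespace Entangled

/-! Let `E` consist of the entries of tuples `(x, ∑ x)`, where `x = x β ∈ ℝⁿ` is chosen by recursion
of length continuum, generic over all earlier choices. The sum is monotone in the entries, so these
`n + 1`-tuples never realize the type in which the sum moves against all other entries. Hence `E` is
not `n + 1`-entangled.

Any `n` of the `n + 1` entries are linearly free, so an `n`-tuple from `E` does not see the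
relation. By Kuratowski–Ulam, applied stage by stage, a tuple of distinct points of stages after `ξ`
avoids the nowhere dense set `K ξ` (`generic_tuple_notMem`). Take for `K ξ` the frontiers of
closures of all countable sets of tuples. A family `F` of size continuum has the closure of some
countable set `D ξ`, and contains a tuple with all stages after `ξ`. That tuple lies in the closure
of `F` but not on its frontier, so every orthant at it meets `F`.

The cardinal hypothesis serves only to meet fewer than continuum many residual conditions at once.
-/

open Set Filter Topology

/-! ### Kuratowski–Ulam along open maps -/

/-- Kuratowski–Ulam theorem for nowhere dense sets, along an open map from a product. -/
theorem eventually_residual_isNowhereDense_section {W Z Y : Type*} [TopologicalSpace W]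
    [TopologicalSpace Z] [TopologicalSpace Y] [SecondCountableTopology Z] {f : W × Z → Y}
    (hf : Continuous f) (ho : IsOpenMap f) {C : Set Y} (hC : IsNowhereDense C) :
    ∀ᶠ w in residual W, IsNowhereDense {z | f (w, z) ∈ C} := by
  let D := closure C
  have hD : IsClosed D := isClosed_closure
  let b := TopologicalSpace.countableBasis Z
  have key : ∀ V ∈ b, ∀ᶠ w in residual W, ¬ V ⊆ {z | f (w, z) ∈ D} := by
    intro V hV
    have hne := TopologicalSpace.nonempty_of_mem_countableBasis hV
    have hVo := TopologicalSpace.isOpen_of_mem_countableBasis hV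
    have hcl : IsClosed {w | V ⊆ {z | f (w, z) ∈ D}} := by
      have : {w | V ⊆ {z | f (w, z) ∈ D}} = ⋂ z ∈ V, {w | f (w, z) ∈ D} := by
        ext w; simp [subset_def]
      rw [this]
      exact isClosed_biInter fun z _ => hD.preimage (by fun_prop)
    have hnd : IsNowhereDense {w | V ⊆ {z | f (w, z) ∈ D}} := by
      rw [hcl.isNowhereDense_iff, eq_empty_iff_forall_notMem]
      intro w hw
      obtain ⟨z, hz⟩ := hne
      -- Openness of `f` turns an open box over this set into an open subset of `D`, whose interior
      -- is empty.
      have hsub : f '' (interior {w | V ⊆ {z | f (w, z) ∈ D}} ×ˢ V) ⊆ D := by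
        rintro _ ⟨⟨w', z'⟩, ⟨hw', hz'⟩, rfl⟩
        exact interior_subset hw' hz'
      have hmem : f (w, z) ∈ interior D :=
        interior_maximal hsub (ho _ (isOpen_interior.prod hVo)) ⟨(w, z), ⟨hw, hz⟩, rfl⟩
      rw [show interior D = ∅ from hC] at hmem
      exact hmem
    exact hnd.isMeagre
  have hall := (eventually_countable_ball (TopologicalSpace.countable_countableBasis Z)).2 key
  filter_upwards [hall] with w hw
  have hcl : IsClosed {z | f (w, z) ∈ D} := hD.preimage (by fun_prop)
  have hsub : {z | f (w, z) ∈ C} ⊆ {z | f (w, z) ∈ D} := fun z hz => subset_closure hz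
  refine IsNowhereDense.mono hsub ?_
  rw [hcl.isNowhereDense_iff]
  by_contra hne
  obtain ⟨z, hz⟩ := nonempty_iff_ne_empty.2 hne
  obtain ⟨V, hV, -, hVs⟩ := (TopologicalSpace.isBasis_countableBasis Z).exists_subset_of_mem_open
    hz isOpen_interior
  exact hw V hV (hVs.trans interior_subset)

/-- Kuratowski–Ulam theorem for meagre sets, along an open map from a product. -/
theorem eventually_residual_isMeagre_section {W Z Y : Type*} [TopologicalSpace W]
    [TopologicalSpace Z] [TopologicalSpace Y] [SecondCountableTopology Z] {f : W × Z → Y}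
    (hf : Continuous f) (ho : IsOpenMap f) {C : Set Y} (hC : IsMeagre C) :
    ∀ᶠ w in residual W, IsMeagre {z | f (w, z) ∈ C} := by
  obtain ⟨S, hS, hc, hsub⟩ := isMeagre_iff_countable_union_isNowhereDense.1 hC
  have hall := (eventually_countable_ball hc).2 fun t ht =>
    eventually_residual_isNowhereDense_section hf ho (hS t ht)
  filter_upwards [hall] with w hw
  refine (isMeagre_biUnion hc fun t ht => (hw t ht).isMeagre).mono fun z hz => ?_
  obtain ⟨t, ht, hzt⟩ := hsub hz
  exact mem_biUnion ht hzt

/-! ### Generic points of `ℝ` and `ℝⁿ` -/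

/-- Fewer than continuum many residual conditions on points of `X` can be met at once. -/
def HasGenericPoints (X : Type) [TopologicalSpace X] : Prop :=
  ∀ (ι : Type) (P : ι → X → Prop), #ι < continuum → (∀ i, ∀ᶠ x in residual X, P i x) →
    ∃ x, ∀ i, P i x

theorem HasGenericPoints.exists_and {X : Type} [TopologicalSpace X] (h : HasGenericPoints X)
    {ι : Type} {P : ι → X → Prop} {Q : X → Prop} (hι : #ι < continuum)
    (hQ : ∀ᶠ x in residual X, Q x) (hP : ∀ i, ∀ᶠ x in residual X, P i x) :
    ∃ x, Q x ∧ ∀ i, P i x := by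
  obtain ⟨x, hx⟩ := h (Option ι) (fun o x => o.elim (Q x) (fun i => P i x)) (by
    rw [mk_option]
    exact add_lt_of_lt aleph0_le_continuum hι (one_lt_aleph0.trans aleph0_lt_continuum)) (by
    rintro (_ | i)
    · exact hQ
    · exact hP i)
  exact ⟨x, hx none, fun i => hx (some i)⟩

/-- Choose `w` so that every condition stays residual on its section, then choose `z` in all these
sections. -/
theorem HasGenericPoints.of_isOpenMap_prod {W Z Y : Type} [TopologicalSpace W]
    [TopologicalSpace Z] [TopologicalSpace Y] [SecondCountableTopology Z]
    (hW : HasGenericPoints W) (hZ : HasGenericPoints Z) {f : W × Z → Y}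
    (hf : Continuous f) (ho : IsOpenMap f) : HasGenericPoints Y := by
  intro ι P hι hP
  obtain ⟨w, hw⟩ := hW ι (fun i w => ∀ᶠ z in residual Z, P i (f (w, z))) hι fun i => by
    have hm : IsMeagre {y | P i y}ᶜ := by
      rw [IsMeagre, compl_compl]; exact hP i
    filter_upwards [eventually_residual_isMeagre_section hf ho hm] with w hw
    filter_upwards [hw] with z hz
    simpa using hz
  obtain ⟨z, hz⟩ := hZ ι _ hι hw
  exact ⟨f (w, z), hz⟩

theorem hasGenericPoints_real
    (H : ∀ S : Set (Set ℝ), (∀ A ∈ S, IsMeagre A) → ⋃₀ S = Set.univ → continuum ≤ #S) :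
    HasGenericPoints ℝ := by
  intro ι P hι hP
  by_contra! hne
  have := H (range fun i => {x | ¬ P i x}) (by
    rintro _ ⟨i, rfl⟩
    exact (congrArg (· ∈ residual ℝ) (by ext x; simp)).mp (hP i)) (by
    ext x; simpa using hne x)
  exact absurd (this.trans mk_range_le) hι.not_ge

theorem isOpenMap_cons (n : ℕ) :
    IsOpenMap fun p : ℝ × (Fin n → ℝ) => (Fin.cons p.1 p.2 : Fin (n + 1) → ℝ) := by
  let L : (ℝ × (Fin n → ℝ)) →ₗ[ℝ] (Fin (n + 1) → ℝ) :=
    { toFun := fun p => Fin.cons p.1 p.2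
      map_add' := fun p q => by ext i; refine Fin.cases ?_ (fun j => ?_) i <;> simp
      map_smul' := fun c p => by ext i; refine Fin.cases ?_ (fun j => ?_) i <;> simp }
  exact L.isOpenMap_of_finiteDimensional fun y =>
    ⟨(y 0, Fin.tail y), Fin.cons_self_tail y⟩

theorem HasGenericPoints.pi (h : HasGenericPoints ℝ) (n : ℕ) : HasGenericPoints (Fin n → ℝ) := by
  induction n with
  | zero =>
    intro ι P _ hP
    refine ⟨Fin.elim0, fun i => ?_⟩
    obtain ⟨x, hx⟩ := (dense_of_mem_residual (hP i)).nonempty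
    rwa [Subsingleton.elim x Fin.elim0] at hx
  | succ n ih =>
    refine h.of_isOpenMap_prod ih ?_ (isOpenMap_cons n)
    refine continuous_pi fun i => ?_
    refine Fin.cases ?_ (fun j => ?_) i
    · simpa using continuous_fst
    · simp only [Fin.cons_succ]; fun_prop

/-! ### Linear algebra of the sum relation -/

/-- An `n`-tuple of reals, extended by the sum of its entries. -/
def snocSum (n : ℕ) : (Fin n → ℝ) →ₗ[ℝ] (Fin (n + 1) → ℝ) where
  toFun x := Fin.snoc x (∑ i, x i)
  map_add' x y := by
    ext i; refine Fin.lastCases ?_ (fun j => ?_) i <;> simp [Finset.sum_add_distrib]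
  map_smul' c x := by
    ext i; refine Fin.lastCases ?_ (fun j => ?_) i <;> simp [Finset.mul_sum]

@[simp] theorem snocSum_castSucc {n : ℕ} (x : Fin n → ℝ) (i : Fin n) :
    snocSum n x i.castSucc = x i := by simp [snocSum]

@[simp] theorem snocSum_last {n : ℕ} (x : Fin n → ℝ) :
    snocSum n x (Fin.last n) = ∑ i, x i := by simp [snocSum]

/-- All entries of `snocSum n x` but one can be prescribed. -/
theorem exists_snocSum_eq {n : ℕ} (m : Fin (n + 1)) (v : Fin (n + 1) → ℝ) :
    ∃ x, ∀ k ≠ m, snocSum n x k = v k := by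
  refine Fin.lastCases ?_ (fun j => ?_) m
  · refine ⟨fun i => v i.castSucc, fun k => ?_⟩
    refine Fin.lastCases (fun h => absurd rfl h) (fun i _ => by simp) k
  · let y : Fin n → ℝ := fun i => v i.castSucc
    refine ⟨Function.update y j (v (Fin.last n) - ∑ i ∈ Finset.univ.erase j, y i), fun k => ?_⟩
    refine Fin.lastCases (fun _ => ?_) (fun i hi => ?_) k
    · rw [snocSum_last, ← Finset.add_sum_erase _ _ (Finset.mem_univ j), Function.update_self,
        Finset.sum_congr rfl fun i hi => Function.update_of_ne (Finset.ne_of_mem_erase hi) _ _]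
      ring
    · have : i ≠ j := fun h => hi (h ▸ rfl)
      simp [Function.update_of_ne this, y]

/-- The map is linear, and onto because `σ` maps `B` to at most `n` of the `n + 1` entries. The
omitted entry absorbs the sum relation. Openness is what Kuratowski–Ulam needs. -/
theorem isOpenMap_piecewise_snocSum {n : ℕ} (B : Finset (Fin n)) {σ : Fin n → Fin (n + 1)}
    (hσ : InjOn σ B) :
    IsOpenMap fun p : (Fin n → ℝ) × (Fin n → ℝ) => B.piecewise (snocSum n p.1 ∘ σ) p.2 := by
  let L : ((Fin n → ℝ) × (Fin n → ℝ)) →ₗ[ℝ] (Fin n → ℝ) :=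
    { toFun := fun p => B.piecewise (snocSum n p.1 ∘ σ) p.2
      map_add' := fun p q => by
        ext i; by_cases hi : i ∈ B <;> simp [hi]
      map_smul' := fun c p => by
        ext i; by_cases hi : i ∈ B <;> simp [hi] }
  refine L.isOpenMap_of_finiteDimensional fun y => ?_
  obtain ⟨m, hm⟩ : ∃ m, m ∉ B.image σ := by
    by_contra! h
    have h1 : (B.image σ).card = n + 1 := by
      rw [Finset.eq_univ_of_forall h, Finset.card_univ, Fintype.card_fin]
    have h2 := (Finset.card_image_le (s := B) (f := σ)).trans (Finset.card_le_univ B)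
    rw [Fintype.card_fin] at h2
    omega
  have hinv : ∃ v : Fin (n + 1) → ℝ, ∀ i ∈ B, v (σ i) = y i := by
    classical
    refine ⟨fun k => if h : ∃ i ∈ B, σ i = k then y h.choose else 0, fun i hi => ?_⟩
    have h : ∃ i' ∈ B, σ i' = σ i := ⟨i, hi, rfl⟩
    simp only [dif_pos h]
    rw [hσ h.choose_spec.1 hi h.choose_spec.2]
  obtain ⟨v, hv⟩ := hinv
  obtain ⟨x, hx⟩ := exists_snocSum_eq m v
  refine ⟨(x, y), ?_⟩
  ext i
  change B.piecewise (snocSum n x ∘ σ) y i = y i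
  by_cases hi : i ∈ B
  · rw [Finset.piecewise_eq_of_mem _ _ _ hi, Function.comp_apply, hx, hv i hi]
    exact fun h => hm (h ▸ Finset.mem_image_of_mem σ hi)
  · rw [Finset.piecewise_eq_of_notMem _ _ _ hi]

theorem continuous_snocSum (n : ℕ) : Continuous (snocSum n) :=
  (snocSum n).continuous_of_finiteDimensional

theorem eventually_residual_linear_ne {n : ℕ} (φ : (Fin n → ℝ) →ₗ[ℝ] ℝ) {v : Fin n → ℝ}
    (hv : φ v ≠ 0) (c : ℝ) : ∀ᶠ x in residual (Fin n → ℝ), φ x ≠ c := by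
  have hs : Function.Surjective φ := φ.surjective fun h => hv (by simp [h])
  have hm : IsMeagre ({c} : Set ℝ) :=
    IsNowhereDense.isMeagre (by rw [isClosed_singleton.isNowhereDense_iff, interior_singleton])
  exact hm.preimage_of_isOpenMap φ.continuous_of_finiteDimensional
    (φ.isOpenMap_of_finiteDimensional hs)

theorem eventually_residual_snocSum_ne {n : ℕ} (hn : 0 < n) (i : Fin (n + 1)) (c : ℝ) :
    ∀ᶠ x in residual (Fin n → ℝ), snocSum n x i ≠ c := by
  have : Nontrivial (Fin (n + 1)) := Fin.nontrivial_iff_two_le.2 (by omega)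
  obtain ⟨m, hm⟩ := exists_ne i
  obtain ⟨x, hx⟩ := exists_snocSum_eq m (fun _ => 1)
  refine eventually_residual_linear_ne (LinearMap.proj i ∘ₗ snocSum n) (v := x) ?_ c
  simp [hx i hm.symm]

theorem eventually_residual_snocSum_injective {n : ℕ} (hn : 1 < n) :
    ∀ᶠ x in residual (Fin n → ℝ), Function.Injective (snocSum n x) := by
  have key : ∀ i j : Fin (n + 1), i ≠ j →
      ∀ᶠ x in residual (Fin n → ℝ), snocSum n x i ≠ snocSum n x j := by
    intro i j hij
    obtain ⟨m, hm⟩ : ∃ m, m ∉ ({i, j} : Finset (Fin (n + 1))) := by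
      by_contra! h
      have h1 := Finset.card_le_two (a := i) (b := j)
      rw [Finset.eq_univ_of_forall h, Finset.card_univ, Fintype.card_fin] at h1
      omega
    simp only [Finset.mem_insert, Finset.mem_singleton, not_or] at hm
    obtain ⟨x, hx⟩ := exists_snocSum_eq m (fun k => if k = i then 1 else 0)
    filter_upwards [eventually_residual_linear_ne
      (LinearMap.proj i ∘ₗ snocSum n - LinearMap.proj j ∘ₗ snocSum n) (v := x)
      (by simp [hx i (Ne.symm hm.1), hx j (Ne.symm hm.2), hij.symm]) 0] with y hy h
    exact hy (by simp [h])
  have hall : ∀ᶠ x in residual (Fin n → ℝ), ∀ i j, i ≠ j → snocSum n x i ≠ snocSum n x j :=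
    eventually_countable_forall.2 fun i => eventually_countable_forall.2 fun j => by
      by_cases hij : i = j
      · simp [hij]
      · simpa [hij] using key i j hij
  filter_upwards [hall] with x hx i j h
  by_contra hij
  exact hx i j hij h

/-! ### The generic recursion -/

theorem exists_wellFounded_sequence {I X : Type*} [LinearOrder I] [WellFoundedLT I]
    {P : ∀ β : I, (Iio β → X) → X → Prop} (h : ∀ β g, ∃ v, P β g v) :
    ∃ x : I → X, ∀ β, P β (fun γ => x γ) (x β) := by
  choose F hF using h
  let x : I → X := (wellFounded_lt (α := I)).fix fun β ih => F β fun γ => ih γ γ.2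
  refine ⟨x, fun β => ?_⟩
  have : x β = F β fun γ => x γ := WellFounded.fix_eq _ _ _
  rw [this]
  exact hF β _

theorem mk_fun_fin_lt_continuum {X : Type} (h : #X < continuum) (n : ℕ) :
    #(Fin n → X) < continuum := by
  induction n with
  | zero => simpa using one_lt_aleph0.trans aleph0_lt_continuum
  | succ n ih =>
    rw [← (Fin.consEquiv fun _ => X).cardinal_eq, mk_prod, lift_id, lift_id]
    exact mul_lt_of_lt aleph0_le_continuum h ih

/-- At stage `β` a condition is given by some `ξ < β` and `n` earlier entries, so there are fewer
than continuum many. The last clause says that fixing further coordinates to entries of stage `β`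
keeps a nowhere dense section nowhere dense. -/
theorem exists_generic_sequence {n : ℕ} (hn : 1 < n) (hgen : HasGenericPoints (Fin n → ℝ))
    {I : Type} [LinearOrder I] [WellFoundedLT I] (hI : ∀ β : I, #(Iio β) < continuum)
    (K : I → Set (Fin n → ℝ)) :
    ∃ x : I → Fin n → ℝ, (∀ β, Function.Injective (snocSum n (x β))) ∧
      (∀ β, ∀ γ < β, ∀ i j, snocSum n (x β) i ≠ snocSum n (x γ) j) ∧
      ∀ β, ∀ ξ < β, ∀ (A B : Finset (Fin n)) (σ : Fin n → Fin (n + 1)), InjOn σ B →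
        ∀ e : Fin n → ℝ, (∀ i ∈ A, ∃ γ < β, ∃ j, snocSum n (x γ) j = e i) →
          IsNowhereDense {z | A.piecewise e z ∈ K ξ} →
          IsNowhereDense {z | A.piecewise e (B.piecewise (snocSum n (x β) ∘ σ) z) ∈ K ξ} := by
  let pt (β : I) (g : Iio β → Fin n → ℝ) (τ : Iio β × Fin (n + 1)) : ℝ := snocSum n (g τ.1) τ.2
  obtain ⟨x, hx⟩ := exists_wellFounded_sequence (I := I) (X := Fin n → ℝ)
    (P := fun β g v => Function.Injective (snocSum n v) ∧
      ∀ q : Iio β × (Fin n → Iio β × Fin (n + 1)),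
        (∀ k i, snocSum n v i ≠ pt β g (q.2 k)) ∧
        ∀ A B : Finset (Fin n), ∀ σ : Fin n → Fin (n + 1), InjOn σ B →
          IsNowhereDense {z | A.piecewise (pt β g ∘ q.2) z ∈ K q.1} →
          IsNowhereDense
            {z | A.piecewise (pt β g ∘ q.2) (B.piecewise (snocSum n v ∘ σ) z) ∈ K q.1}) (by
    intro β g
    refine hgen.exists_and ?_ (eventually_residual_snocSum_injective hn) fun q => ?_
    · rw [mk_prod, lift_id, lift_id]
      refine mul_lt_of_lt aleph0_le_continuum (hI β) (mk_fun_fin_lt_continuum ?_ n)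
      rw [mk_prod, lift_id, lift_id]
      exact mul_lt_of_lt aleph0_le_continuum (hI β)
        ((lt_aleph0_of_finite _).trans aleph0_lt_continuum)
    · refine Eventually.and ?_ ?_
      · exact eventually_countable_forall.2 fun k => eventually_countable_forall.2 fun i =>
          eventually_residual_snocSum_ne (by omega) i _
      · refine eventually_countable_forall.2 fun A => eventually_countable_forall.2 fun B =>
          eventually_countable_forall.2 fun σ => ?_
        by_cases hσ : InjOn σ B
        · by_cases hK : IsNowhereDense {z | A.piecewise (pt β g ∘ q.2) z ∈ K q.1}
          · filter_upwards [eventually_residual_isNowhereDense_section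
              (f := fun p : (Fin n → ℝ) × (Fin n → ℝ) => B.piecewise (snocSum n p.1 ∘ σ) p.2)
              (by
                refine continuous_pi fun i => ?_
                have := continuous_snocSum n
                by_cases hi : i ∈ B
                · simp only [Finset.piecewise_eq_of_mem _ _ _ hi, Function.comp_apply]
                  fun_prop
                · simp only [Finset.piecewise_eq_of_notMem _ _ _ hi]
                  fun_prop)
              (isOpenMap_piecewise_snocSum B hσ) hK] with v hv _ _
            exact hv
          · exact Eventually.of_forall fun v _ h => absurd h hK
        · exact Eventually.of_forall fun v h => absurd h hσ)
  refine ⟨x, fun β => (hx β).1, fun β γ hγ i j => ?_, fun β ξ hξ A B σ hσ e he hK => ?_⟩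
  · exact ((hx β).2 (⟨γ, hγ⟩, fun _ => (⟨γ, hγ⟩, j))).1 ⟨0, by omega⟩ i
  · have hτ : ∀ i, ∃ τ : Iio β × Fin (n + 1), i ∈ A → pt β (fun γ => x γ) τ = e i := by
      intro i
      by_cases hi : i ∈ A
      · obtain ⟨γ, hγ, j, hj⟩ := he i hi
        exact ⟨(⟨γ, hγ⟩, j), fun _ => hj⟩
      -- A dummy value: coordinates outside `A` are never read.
      · exact ⟨(⟨ξ, hξ⟩, 0), fun h => absurd h hi⟩
    choose τ hτ using hτ
    have heq : ∀ z, A.piecewise (pt β (fun γ => x γ) ∘ τ) z = A.piecewise e z := fun z =>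
      A.piecewise_congr (fun i hi => hτ i hi) fun _ _ => rfl
    have := ((hx β).2 (⟨ξ, hξ⟩, τ)).2 A B σ hσ
    simp only [heq] at this
    exact this hK

/-- A tuple of distinct entries of a generic sequence, all of stages after `ξ`, avoids `K ξ`. -/
theorem generic_tuple_notMem {n : ℕ} {I : Type} [LinearOrder I] {K : I → Set (Fin n → ℝ)}
    {x : I → Fin n → ℝ} {ξ : I} (hK : IsNowhereDense (K ξ))
    (hx : ∀ β, ξ < β → ∀ (A B : Finset (Fin n)) (σ : Fin n → Fin (n + 1)), InjOn σ B →
        ∀ e : Fin n → ℝ, (∀ i ∈ A, ∃ γ < β, ∃ j, snocSum n (x γ) j = e i) →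
          IsNowhereDense {z | A.piecewise e z ∈ K ξ} →
          IsNowhereDense {z | A.piecewise e (B.piecewise (snocSum n (x β) ∘ σ) z) ∈ K ξ})
    {e : Fin n → ℝ} (he : Function.Injective e) {s : Fin n → I} {σ : Fin n → Fin (n + 1)}
    (hs : ∀ i, ξ < s i) (hes : ∀ i, snocSum n (x (s i)) (σ i) = e i) : e ∉ K ξ := by
  -- Coordinates are fixed in order of stage: `B` holds those of the latest stage in `A`, and `A'`
  -- the earlier ones, covered by induction.
  have key : ∀ A : Finset (Fin n), IsNowhereDense {z | A.piecewise e z ∈ K ξ} := by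
    intro A
    induction A using Finset.strongInduction with
    | H A ih =>
      rcases A.eq_empty_or_nonempty with rfl | hA
      · simpa using hK
      obtain ⟨i₀, hi₀, hmax⟩ := A.exists_max_image s hA
      let A' := A.filter fun i => s i < s i₀
      let B := A.filter fun i => s i = s i₀
      have hA' : A' ⊂ A := Finset.filter_ssubset.2 ⟨i₀, hi₀, lt_irrefl _⟩
      have hσ : InjOn σ B := by
        intro i hi j hj hij
        have hi' := (Finset.mem_filter.1 hi).2
        have hj' := (Finset.mem_filter.1 hj).2
        apply he
        rw [← hes i, ← hes j, hi', hj', hij]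
      have := hx (s i₀) (hs i₀) A' B σ hσ e
        (fun i hi => ⟨s i, (Finset.mem_filter.1 hi).2, σ i, hes i⟩) (ih A' hA')
      have heq : ∀ z, A.piecewise e z =
          A'.piecewise e (B.piecewise (snocSum n (x (s i₀)) ∘ σ) z) := by
        intro z
        ext i
        by_cases h1 : i ∈ A'
        · simp [h1, hA'.1 h1]
        · by_cases h2 : i ∈ B
          · have h2' := Finset.mem_filter.1 h2
            rw [Finset.piecewise_eq_of_mem _ _ _ h2'.1, Finset.piecewise_eq_of_notMem _ _ _ h1,
              Finset.piecewise_eq_of_mem _ _ _ h2, ← hes i, h2'.2, Function.comp_apply]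
          · have : i ∉ A := fun hi => (hmax i hi).lt_or_eq.elim
              (fun h => h1 (Finset.mem_filter.2 ⟨hi, h⟩))
              (fun h => h2 (Finset.mem_filter.2 ⟨hi, h⟩))
            simp only [h1, h2, this, not_false_eq_true, Finset.piecewise_eq_of_notMem]
      simpa only [heq] using this
  intro hmem
  -- With all coordinates fixed, the section would be the whole space.
  have := key Finset.univ
  simp [hmem, IsNowhereDense] at this

/-! ### Realizing types, and the final construction -/

/-- A point in the interior of the closure of a set of tuples realizes every type with some member
of the set. -/
theorem exists_tupleType_eq {n : ℕ} {F : Set (Fin n → ℝ)} {e : Fin n → ℝ}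
    (he : e ∈ interior (closure F)) (t : Fin n → Bool) :
    ∃ e' ∈ F, (∀ i, e' i ≠ e i) ∧ tupleType e e' = t := by
  let O : Set (Fin n → ℝ) := {y | ∀ i, if t i then y i < e i else e i < y i}
  have hO : IsOpen O := by
    have : O = ⋂ i, {y | if t i then y i < e i else e i < y i} := by ext; simp [O]
    rw [this]
    refine isOpen_iInter_of_finite fun i => ?_
    cases t i
    · simpa using isOpen_lt continuous_const (continuous_apply i)
    · simpa using isOpen_lt (continuous_apply i) continuous_const
  have hcl : e ∈ closure O := by
    let y : ℝ → Fin n → ℝ := fun r i => if t i then e i - r else e i + r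
    have hy : Tendsto y (𝓝[>] 0) (𝓝 e) := by
      refine Tendsto.mono_left ?_ nhdsWithin_le_nhds
      have hc : Continuous y := continuous_pi fun i => by
        cases h : t i <;> simp only [y, h, if_true, Bool.false_eq_true, if_false] <;> fun_prop
      have h0 : y 0 = e := by ext i; simp [y]
      exact h0 ▸ hc.tendsto 0
    refine mem_closure_of_tendsto hy ?_
    filter_upwards [self_mem_nhdsWithin] with r hr i
    have hr' : (0 : ℝ) < r := hr
    by_cases h : t i <;> simp [y, h, hr']
  obtain ⟨y, hyI, hyO⟩ := mem_closure_iff.1 hcl _ isOpen_interior he |>.imp fun _ h => h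
  obtain ⟨e', he', heF⟩ := mem_closure_iff.1 (interior_subset hyI) O hO hyO
  refine ⟨e', heF, fun i => ?_, ?_⟩
  · have := he' i
    by_cases h : t i <;> simp only [h] at this
    · exact (by simpa using this : e' i < e i).ne
    · exact (by simpa using this : e i < e' i).ne'
  · ext i
    have := he' i
    by_cases h : t i <;> simp only [h] at this
    · simpa [tupleType, h] using this
    · simpa [tupleType, h] using (by simpa using this : e i < e' i).le

/-- Among more pairwise disjoint tuples than there are elements of `S`, one avoids `S`. -/
theorem exists_tuple_avoiding {L : Type} {n : ℕ} {F : Set (Fin n → L)} {S : Set L}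
    (hd : ∀ e ∈ F, ∀ e' ∈ F, e ≠ e' → Disjoint (range e) (range e')) (h : #S < #F) :
    ∃ e ∈ F, ∀ i, e i ∉ S := by
  by_contra! hne
  choose k hk using hne
  refine h.not_ge (mk_le_of_injective (f := fun e : F => (⟨e.1 (k e.1 e.2), hk e.1 e.2⟩ : S)) ?_)
  intro e e' hee
  by_contra hne
  have heq : e.1 (k e.1 e.2) = e'.1 (k e'.1 e'.2) := congrArg Subtype.val hee
  exact disjoint_left.1 (hd e e.2 e' e'.2 fun h => hne (Subtype.ext h)) ⟨_, rfl⟩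
    ⟨_, heq.symm⟩

theorem exists_entangled_not_entangled_succ (hgen : HasGenericPoints ℝ) {n : ℕ} (hn : 1 < n) :
    ∃ E : Set ℝ, IsEntangled continuum n E ∧ ¬ IsEntangled continuum (n + 1) E := by
  let I := continuum.{0}.ord.ToType
  -- `D` enumerates all sequences of tuples in order type continuum, each stage having fewer than
  -- continuum many predecessors.
  have hcard : #I = #(ℕ → Fin n → ℝ) := by
    simp [I, mk_real, power_nat_eq aleph0_le_continuum (n := n) (by omega)]
  obtain ⟨D⟩ := Cardinal.eq.1 hcard
  have hIc : #I = continuum := mk_ord_toType _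
  have hI : ∀ β : I, #(Iio β) < continuum := fun β =>
    (mk_Iio_lt β (by simp [I])).trans_eq hIc
  let K : I → Set (Fin n → ℝ) := fun ξ => frontier (closure (range (D ξ)))
  obtain ⟨x, hinj, hne, hx⟩ := exists_generic_sequence hn (hgen.pi n) hI K
  have hne' : ∀ β γ, β ≠ γ → ∀ i j, snocSum n (x β) i ≠ snocSum n (x γ) j := by
    intro β γ hβγ i j
    rcases hβγ.lt_or_gt with h | h
    · exact (hne γ β h j i).symm
    · exact hne β γ h i j
  let E : Set ℝ := range fun q : I × Fin (n + 1) => snocSum n (x q.1) q.2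
  let pt (β : I) (i : Fin (n + 1)) : E := ⟨snocSum n (x β) i, (β, i), rfl⟩
  have hptinj : ∀ β, Function.Injective (pt β) := fun β i j h =>
    hinj β (congrArg Subtype.val h)
  have hptdisj : ∀ β γ i j, pt β i = pt γ j → β = γ := by
    intro β γ i j h
    by_contra hβγ
    exact hne' β γ hβγ i j (congrArg Subtype.val h)
  refine ⟨E, ⟨?_, ?_⟩, ?_⟩
  · rw [← hIc]
    exact mk_le_of_injective (f := fun β => pt β 0) fun β γ h => hptdisj β γ 0 0 h
  · intro F hF hFinj hFdisj t
    let v : (Fin n → E) → Fin n → ℝ := fun e i => e i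
    have hFne : F.Nonempty := by
      rw [← mk_set_ne_zero_iff, hF]; exact continuum_ne_zero
    have : Nonempty (v '' F) := (hFne.image v).to_subtype
    obtain ⟨u, hu⟩ := TopologicalSpace.exists_dense_seq (v '' F)
    obtain ⟨ξ, hξ⟩ := D.surjective fun k => (u k : Fin n → ℝ)
    have hcl : closure (range (D ξ)) = closure (v '' F) := by
      rw [hξ]
      apply subset_antisymm
      · apply closure_mono
        rintro _ ⟨k, rfl⟩
        exact (u k).2
      · refine closure_minimal (fun y hy => ?_) isClosed_closure
        have h1 := hu ⟨y, hy⟩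
        have h2 := image_closure_subset_closure_image (f := Subtype.val) continuous_subtype_val
          (mem_image_of_mem Subtype.val h1)
        rwa [← range_comp] at h2
    -- The points of stages up to `ξ`: too few to meet every member of the disjoint family `F`.
    let S : Set E := range fun q : Iic ξ × Fin (n + 1) => pt q.1 q.2
    have hS : #S < #F := by
      rw [hF]
      refine mk_range_le.trans_lt ?_
      rw [mk_prod, lift_id, lift_id]
      refine mul_lt_of_lt aleph0_le_continuum ?_
        ((lt_aleph0_of_finite _).trans aleph0_lt_continuum)
      rw [← Iio_insert]
      exact mk_insert_le.trans_lt (add_lt_of_lt aleph0_le_continuum (hI ξ)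
        (one_lt_aleph0.trans aleph0_lt_continuum))
    obtain ⟨e, heF, heS⟩ := exists_tuple_avoiding hFdisj hS
    have hq : ∀ i, ∃ q : I × Fin (n + 1), snocSum n (x q.1) q.2 = v e i := fun i => (e i).2
    choose q hq using hq
    have heK : v e ∉ K ξ := by
      refine generic_tuple_notMem (x := x) (s := fun i => (q i).1) (σ := fun i => (q i).2)
        ?_ (fun β hβ => hx β ξ hβ) (fun i j h => hFinj e heF (Subtype.ext h)) ?_ hq
      · rw [isClosed_frontier.isNowhereDense_iff, interior_frontier isClosed_closure]
      · intro i
        by_contra! hle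
        exact heS i ⟨(⟨(q i).1, hle⟩, (q i).2), Subtype.ext (hq i)⟩
    have heI : v e ∈ interior (closure (v '' F)) := by
      by_contra hnot
      refine heK ?_
      simp only [K]
      rw [isClosed_closure.frontier_eq, hcl]
      exact ⟨subset_closure ⟨e, heF, rfl⟩, hnot⟩
    obtain ⟨_, ⟨e', he'F, rfl⟩, hne, ht⟩ := exists_tupleType_eq heI t
    refine ⟨e, heF, e', he'F, ?_, Or.inl ht⟩
    rintro rfl
    exact hne ⟨0, by omega⟩ rfl
  · rintro ⟨-, h⟩
    obtain ⟨_, ⟨β, rfl⟩, _, ⟨γ, rfl⟩, hβγ, hr⟩ := h (range pt)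
      (by
        rw [mk_range_eq, hIc]
        exact fun β γ h => hptdisj β γ 0 0 (congrFun h 0))
      (by rintro _ ⟨β, rfl⟩; exact hptinj β)
      (by
        rintro _ ⟨β, rfl⟩ _ ⟨γ, rfl⟩ hβγ
        rw [disjoint_left]
        rintro _ ⟨i, rfl⟩ ⟨j, hj⟩
        exact hβγ (congrArg pt (hptdisj γ β j i hj).symm))
      -- Realizing this type or its complement would set the change of the sum against that of all
      -- its summands.
      (fun i => decide (i = Fin.last n))
    have : NeZero n := ⟨by omega⟩
    have hlt : ∀ i, pt γ i < pt β i ↔ snocSum n (x γ) i < snocSum n (x β) i := fun _ => Iff.rfl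
    rcases hr with hr | hr
    · have h1 := congrFun hr (Fin.last n)
      simp only [tupleType, hlt, snocSum_last, decide_true, decide_eq_true_eq] at h1
      refine h1.not_ge (Finset.sum_le_sum fun i _ => ?_)
      have h2 := congrFun hr i.castSucc
      simpa [tupleType, hlt, (Fin.castSucc_lt_last i).ne] using h2
    · have h1 := congrFun hr (Fin.last n)
      simp only [tupleType, hlt, snocSum_last, decide_true, Bool.not_true,
        decide_eq_false_iff_not, not_lt] at h1
      refine h1.not_gt (Finset.sum_lt_sum_of_nonempty Finset.univ_nonempty fun i _ => ?_)
      have h2 := congrFun hr i.castSucc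
      simpa [tupleType, hlt, (Fin.castSucc_lt_last i).ne] using h2

end Entangled

theorem mainTheorem1 :
    (Entangled.covMeager = Cardinal.continuum →
      ∀ n : ℕ, 1 < n → ∃ E : Set ℝ,
        Entangled.IsEntangled Cardinal.continuum n E ∧
          ¬ Entangled.IsEntangled Cardinal.continuum (n + 1) E) ∧
    (Cardinal.aleph 1 = Cardinal.continuum →
      ∀ n : ℕ, 1 < n → ∃ E : Set ℝ,
        Entangled.IsEntangled (Cardinal.aleph 1) n E ∧
          ¬ Entangled.IsEntangled (Cardinal.aleph 1) (n + 1) E) := by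
  refine ⟨fun hcov n hn => ?_, fun hCH n hn => ?_⟩
  · refine Entangled.exists_entangled_not_entangled_succ
      (Entangled.hasGenericPoints_real fun S hS hU => ?_) hn
    rw [← hcov]
    exact csInf_le' ⟨S, rfl, hS, hU⟩
  · have hCH : ℵ_ 1 = continuum.{0} := lift_injective (by simpa using hCH)
    rw [hCH]
    refine Entangled.exists_entangled_not_entangled_succ
      (Entangled.hasGenericPoints_real fun S hS hU => ?_) hn
    -- Under CH a smaller cover would be countable, against the Baire category theorem.
    rw [← hCH, ← succ_aleph0, Order.succ_le_iff]
    by_contra! hle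
    have hc : S.Countable := le_aleph0_iff_set_countable.1 hle
    refine not_isMeagre_of_isOpen (X := ℝ) isOpen_univ Set.univ_nonempty ?_
    rw [← hU, Set.sUnion_eq_biUnion]
    exact isMeagre_biUnion hc hS
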